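/- Let $n,m\ge 1$ be integers and let $$Q(x)=x^{4n}+a_1x^{4n-2}+a_2x^{4n-4}+\cdots+a_2x^4+a_1x^2+1$$ be a monic even palindromic polynomial of degree $4n$ with complex (in particular, possibly real) coefficients and without real zeros. Then there are complex numbers $w_1,\dots,w_n$ with $\operatorname{Re} w_j>0$ such that $$Q(x)=\prod_{j=1}^n (x^2+w_j^2)(x^2+w_j^{-2}).$$ For every such choice of $w_1,\dots,w_n$, let $q$ be the $2nm$-tuple obtained by concatenating, for $j=1,\dots,n$, the tuples $(w_j,\dots,w_j,w_j^{-1},\dots,w_j^{-1})$ with $m$ copies of $w_j$ and $m$ copies of $w_j^{-1}$. For $s\ge 1$ let $\lambda(s)$ be the partition $(s-1,s-2,\dots,1)$, and for a partition $\mu$ with at most $N$ parts (padded with zeros to length $N$) let $s_\mu$ be the Schur polynomial in $N=2nm$ variables, that is, the polynomial $$s_\mu(X_1,\dots,X_N)=\frac{\det\bigl(X_i^{\mu_j+N-j}\bigr)_{1\le i,j\le N}}{\det\bigl(X_i^{N-j}\bigr)_{1\le i,j\le N}}.$$ Then the function $x\mapsto Q(x)^{-m}$ is integrable on $(0,\infty)$,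 $s_{\lambda(2nm)}(q)\neq 0$, and $$\int_0^\infty\frac{dx}{Q(x)^m}=\frac{\pi}{2}\,\frac{s_{\lambda(2nm-1)}(q)}{s_{\lambda(2nm)}(q)}.$$ -/

import Mathlib

open MeasureTheory

noncomputable section

namespace PalindromicIntegral

/-- The alternant `a_α = det (X_i ^ α_j)` as a polynomial in the variables `X_0, …, X_{N-1}`. -/
def alternant {N : ℕ} (α : Fin N → ℕ) : MvPolynomial (Fin N) ℤ :=
  (Matrix.of fun i j : Fin N => (MvPolynomial.X i : MvPolynomial (Fin N) ℤ) ^ α j).det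

/-- The staircase partition `λ(s) = (s-1, s-2, …, 1)`, as an `N`-tuple of parts padded with zeros
(for `s ≤ N + 1` no part is lost). The subtraction is truncated: that is the padding. -/
def staircase (s : ℕ) {N : ℕ} : Fin N → ℕ := fun j => s - 1 - (j : ℕ)

/-- The substitution `X_i ↦ X_j`. -/
def identify {N : ℕ} (i j : Fin N) :
    MvPolynomial (Fin N) ℤ →ₐ[ℤ] MvPolynomial (Fin N) ℤ :=
  MvPolynomial.aeval fun k => if k = i then MvPolynomial.X j else MvPolynomial.X k

theorem X_sub_X_dvd_iff {N : ℕ} (i j : Fin N) (p : MvPolynomial (Fin N) ℤ) :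
    (MvPolynomial.X i - MvPolynomial.X j : MvPolynomial (Fin N) ℤ) ∣ p ↔ identify i j p = 0 := by
  constructor
  · rintro ⟨c, rfl⟩
    have : identify i j (MvPolynomial.X i - MvPolynomial.X j) = 0 := by
      simp [identify]
    rw [map_mul, this, zero_mul]
  · intro h
    let I : Ideal (MvPolynomial (Fin N) ℤ) :=
      Ideal.span {MvPolynomial.X i - MvPolynomial.X j}
    have key : (Ideal.Quotient.mkₐ ℤ I).comp (identify i j) = Ideal.Quotient.mkₐ ℤ I := by
      apply MvPolynomial.algHom_ext
      intro k
      by_cases hk : k = i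
      · subst hk
        simp only [identify, AlgHom.comp_apply, MvPolynomial.aeval_X, if_true]
        symm
        rw [Ideal.Quotient.mkₐ_eq_mk, Ideal.Quotient.eq]
        exact Ideal.subset_span rfl
      · simp [identify, hk]
    have h2 := DFunLike.congr_fun key p
    rw [AlgHom.comp_apply, h, map_zero] at h2
    have h3 : p ∈ I := by
      rw [← Ideal.Quotient.eq_zero_iff_mem]
      exact h2.symm
    exact Ideal.mem_span_singleton.mp h3

theorem X_sub_X_prime {N : ℕ} {i j : Fin N} (hij : i ≠ j) :
    Prime (MvPolynomial.X i - MvPolynomial.X j : MvPolynomial (Fin N) ℤ) := by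
  refine ⟨?_, ?_, ?_⟩
  · rw [sub_ne_zero]
    exact fun h => hij (MvPolynomial.X_injective h)
  · intro h
    have := (X_sub_X_dvd_iff i j 1).mp h.dvd
    simp at this
  · intro a b h
    rw [X_sub_X_dvd_iff, map_mul, mul_eq_zero] at h
    simpa only [X_sub_X_dvd_iff] using h

theorem X_sub_X_dvd_alternant {N : ℕ} (α : Fin N → ℕ) {i j : Fin N} (hij : i ≠ j) :
    (MvPolynomial.X i - MvPolynomial.X j : MvPolynomial (Fin N) ℤ) ∣ alternant α := by
  rw [X_sub_X_dvd_iff, alternant, AlgHom.map_det]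
  apply Matrix.det_zero_of_row_eq hij
  funext k
  simp [identify, hij.symm]

theorem alternant_staircase {N : ℕ} :
    Associated (alternant (staircase N : Fin N → ℕ))
      (∏ p ∈ (Finset.univ : Finset (Fin N × Fin N)) with p.1 < p.2,
        (MvPolynomial.X p.2 - MvPolynomial.X p.1 : MvPolynomial (Fin N) ℤ)) := by
  have h1 : (∏ p ∈ (Finset.univ : Finset (Fin N × Fin N)) with p.1 < p.2,
        (MvPolynomial.X p.2 - MvPolynomial.X p.1 : MvPolynomial (Fin N) ℤ))
      = (Matrix.vandermonde (fun i : Fin N => (MvPolynomial.X i : MvPolynomial (Fin N) ℤ))).det := by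
    rw [Matrix.det_vandermonde, Finset.prod_filter, ← Finset.univ_product_univ,
      Finset.prod_product]
    refine Finset.prod_congr rfl fun i _ => ?_
    rw [← Finset.prod_filter]
    refine Finset.prod_congr ?_ fun _ _ => rfl
    ext; simp
  have h2 : alternant (staircase N : Fin N → ℕ)
      = ((Matrix.vandermonde (fun i : Fin N =>
          (MvPolynomial.X i : MvPolynomial (Fin N) ℤ))).submatrix id Fin.revPerm).det := by
    rw [alternant]
    congr 1
    ext1 i j
    simp only [Matrix.of_apply, staircase, Matrix.submatrix_apply, Matrix.vandermonde_apply,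
      Fin.revPerm_apply, Fin.val_rev, id]
    congr 1
    omega
  rw [h1, h2, Matrix.det_permute']
  rcases Int.units_eq_one_or (Equiv.Perm.sign (Fin.revPerm : Equiv.Perm (Fin N))) with h | h <;>
    rw [h] <;> simp

/-- Every alternant is divisible by the Vandermonde alternant. -/
theorem alternant_staircase_dvd {N : ℕ} (α : Fin N → ℕ) :
    alternant (staircase N : Fin N → ℕ) ∣ alternant α := by
  rw [alternant_staircase.dvd_iff_dvd_left]
  apply Finset.prod_dvd_of_isRelPrime
  · rintro ⟨i, j⟩ hp ⟨k, l⟩ hq hne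
    simp only [Finset.coe_filter, Finset.mem_univ, true_and, Set.mem_ofPred_eq] at hp hq
    show IsRelPrime (MvPolynomial.X j - MvPolynomial.X i : MvPolynomial (Fin N) ℤ)
      (MvPolynomial.X l - MvPolynomial.X k)
    rw [(X_sub_X_prime hp.ne').irreducible.isRelPrime_iff_not_dvd, X_sub_X_dvd_iff]
    intro h
    simp only [identify, map_sub, MvPolynomial.aeval_X, sub_eq_zero] at h
    apply hne
    have hX : ∀ a b : Fin N, (MvPolynomial.X a : MvPolynomial (Fin N) ℤ) = MvPolynomial.X b →
      a = b := fun a b hab => MvPolynomial.X_injective hab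
    split_ifs at h with c1 c2 c2
    · omega
    · have := hX _ _ h
      ext <;> simp <;> omega
    · have := hX _ _ h
      omega
    · have := hX _ _ h
      omega
  · rintro ⟨i, j⟩ hp
    simp only [Finset.mem_filter, Finset.mem_univ, true_and] at hp
    exact X_sub_X_dvd_alternant α hp.ne'

/-- The Schur polynomial `s_μ = a_{μ + λ(N)} / a_{λ(N)}` in `N` variables, for a partition `μ` with
at most `N` parts: the (unique) polynomial with `a_{μ + λ(N)} = a_{λ(N)} * s_μ`. -/
def schurPoly {N : ℕ} (μ : Fin N → ℕ) : MvPolynomial (Fin N) ℤ :=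
  (alternant_staircase_dvd (μ + staircase N)).choose

theorem schurPoly_spec {N : ℕ} (μ : Fin N → ℕ) :
    alternant (μ + staircase N) = alternant (staircase N) * schurPoly μ :=
  (alternant_staircase_dvd (μ + staircase N)).choose_spec

/-- The Schur polynomial `s_μ` evaluated at a tuple `q` of complex numbers, possibly with
repetitions. -/
def schur {N : ℕ} (μ : Fin N → ℕ) (q : Fin N → ℂ) : ℂ :=
  MvPolynomial.aeval q (schurPoly μ)

/-- The concatenation, over `j = 0, …, n-1`, of the `2m`-tuples
`(w_j, …, w_j, w_j⁻¹, …, w_j⁻¹)` with `m` copies of `w_j` and `m` copies of `w_j⁻¹`. -/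
def concatTuple {n : ℕ} (m : ℕ) (w : Fin n → ℂ) : Fin (n * (2 * m)) → ℂ := fun k =>
  if (k.modNat : ℕ) < m then w k.divNat else (w k.divNat)⁻¹

/-- `Q` is a monic palindromic even polynomial of degree `4n`:
`Q = x^{4n} + a₁ x^{4n-2} + a₂ x^{4n-4} + ⋯ + a₂ x⁴ + a₁ x² + 1`. -/
structure IsEvenPalindromic (n : ℕ) (Q : Polynomial ℂ) : Prop where
  monic : Q.Monic
  natDegree_eq : Q.natDegree = 4 * n
  even : ∀ i : ℕ, Odd i → Q.coeff i = 0
  palindromic : Q.reverse = Q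

end PalindromicIntegral

end

/-! Since `Q` is even, `Q(x) = R(x²)` with `R` palindromic and without roots in `[0, ∞)`. The roots
of `R` pair off as `r, r⁻¹`, and `w` is the principal square root of `-r`;
`exists_palindromic_factorization` removes one pair at a time.

For the integral, `Q(x)^m = ∏ (x² + q_i²)` with `∏ q_i = 1`. The proof works with any `N + 1`
parameters in the right half-plane and shows that the integral times `∏ q_i` times `s_{λ(N+1)}(q)`
equals `π/2 · s_{λ(N)}(q)`. If the `q_i` are distinct, partial fractions and `∫₀^∞ dx/(x² + z²) =
π/(2z)` give a sum that is, up to the factor `π/2 · ∏ q_i⁻²`, the value at `0` of the polynomial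
interpolating `q_i` at the nodes `q_i²`. By Cramer's rule (`det_updateCol_last_pow_sub`) that value
is a quotient of determinants: below, the Vandermonde determinant in the `q_i²`; above, the same
with its constant column replaced by the `q_i`. Taking `q_i` out of each row above leaves the
alternants that define the two Schur polynomials (`schur_staircase_pred`). Both sides are continuous
in `q`, so repeated parameters follow by a limit (`integral_mul_prod_mul_schur`). The denominator is
`∏_{i<j} (q_i + q_j)`, whose factors have positive real part. -/

open Polynomial in
theorem reverse_X_add_C_complex (a : ℂ) : (X + C a : ℂ[X]).reverse = 1 + C a * X := by
  ext i
  rw [coeff_reverse, natDegree_X_add_C]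
  rcases i with _ | _ | i
  · simp [coeff_one, coeff_X]
  · simp [coeff_one, coeff_X]
  · have h : revAt 1 (i + 1 + 1) = i + 1 + 1 := revAt_eq_self_of_lt (by omega)
    rw [h]
    simp [coeff_one, coeff_X]

open Polynomial in
/-- A monic palindromic polynomial of even degree having no nonnegative real root is a product of
factors `(y + w²)(y + w⁻²)`, where `w` may be chosen in the open right half-plane. -/
theorem exists_palindromic_factorization (n : ℕ) (R : ℂ[X]) (hR : R.Monic)
    (hdeg : R.natDegree = 2 * n) (hrev : R.reverse = R)
    (hroot : ∀ x : ℝ, 0 ≤ x → R.eval (x : ℂ) ≠ 0) :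
    ∃ w : Fin n → ℂ, (∀ j, 0 < (w j).re) ∧
      R = ∏ j, ((X + C (w j ^ 2)) * (X + C ((w j)⁻¹ ^ 2))) := by
  induction n generalizing R with
  | zero => exact ⟨Fin.elim0, fun j => j.elim0, by simpa using hR.natDegree_eq_zero.mp hdeg⟩
  | succ n ih =>
    obtain ⟨r, hr⟩ := Complex.exists_root (f := R) (by
      rw [degree_eq_natDegree hR.ne_zero, hdeg]; exact_mod_cast (by omega : 0 < 2 * (n + 1)))
    -- As `r` is not a nonnegative real, `-r` avoids the branch cut and its principal square root
    -- has positive real part.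
    have hslit : -r ∈ Complex.slitPlane := by
      by_contra h
      rw [Complex.mem_slitPlane_iff] at h
      push Not at h
      simp only [Complex.neg_re, Complex.neg_im, neg_eq_zero] at h
      apply hroot r.re (by linarith)
      have : ((r.re : ℝ) : ℂ) = r := by apply Complex.ext <;> simp [h.2]
      rw [this]; exact hr
    have hr0 : r ≠ 0 := fun h => Complex.slitPlane_ne_zero hslit (by simp [h])
    obtain ⟨w₀, hw₀, hw₀r⟩ : ∃ w₀ : ℂ, 0 < w₀.re ∧ w₀ ^ 2 = -r := by
      refine ⟨(-r) ^ (2⁻¹ : ℂ), ?_, ?_⟩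
      · rw [Complex.cpow_def_of_ne_zero (neg_ne_zero.mpr hr0), Complex.exp_re]
        apply mul_pos (Real.exp_pos _)
        have h1 := Complex.neg_pi_lt_arg (-r)
        have h2 := lt_of_le_of_ne (Complex.arg_le_pi (-r)) (Complex.slitPlane_arg_ne_pi hslit)
        have : (Complex.log (-r) * 2⁻¹).im = (-r).arg / 2 := by
          rw [← Complex.log_im, Complex.mul_im]; norm_num; ring
        rw [this]
        apply Real.cos_pos_of_mem_Ioo
        constructor <;> linarith
      · exact_mod_cast Complex.cpow_nat_inv_pow (-r) two_ne_zero
    have hw₀0 : w₀ ≠ 0 := by rintro rfl; simp at hw₀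
    set A : ℂ[X] := (X + C (w₀ ^ 2)) * (X + C (w₀⁻¹ ^ 2)) with hA
    have hAmonic : A.Monic := (monic_X_add_C _).mul (monic_X_add_C _)
    have hAdeg : A.natDegree = 2 := by
      rw [hA, (monic_X_add_C _).natDegree_mul (monic_X_add_C _), natDegree_X_add_C,
        natDegree_X_add_C]
    have hww : (C (w₀ ^ 2) * C (w₀⁻¹ ^ 2) : ℂ[X]) = 1 := by
      rw [← C_mul, ← mul_pow, mul_inv_cancel₀ hw₀0, one_pow, C_1]
    have hArev : A.reverse = A := by
      rw [hA, reverse_mul_of_domain, reverse_X_add_C_complex, reverse_X_add_C_complex]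
      linear_combination (X ^ 2 - 1 : ℂ[X]) * hww
    obtain ⟨R₁, hR₁⟩ : A ∣ R := by
      obtain ⟨S, hS⟩ := dvd_iff_isRoot.mpr hr
      have hfac : (X - C r : ℂ[X]) = X + C (w₀ ^ 2) := by rw [hw₀r]; simp [sub_eq_add_neg]
      rw [hfac] at hS
      have hSdeg : S.natDegree = 2 * n + 1 := by
        have hSm : S.Monic := (monic_X_add_C _).of_mul_monic_left (hS ▸ hR)
        have := (monic_X_add_C (w₀ ^ 2)).natDegree_mul hSm
        rw [← hS, hdeg, natDegree_X_add_C] at this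
        omega
      suffices h : S.IsRoot (-(w₀⁻¹ ^ 2)) by
        obtain ⟨T, hT⟩ := dvd_iff_isRoot.mpr h
        refine ⟨T, ?_⟩
        rw [hS, hT, hA, C_neg, sub_neg_eq_add, mul_assoc]
      -- Here `r = -1` is its own reciprocal and must be a multiple root: the cofactor `S` is
      -- palindromic of odd degree, so `S(-1) = -S(-1)`. Otherwise `r⁻¹` is a root of `R` other than
      -- `r`, hence a root of `S`.
      by_cases h1 : w₀ ^ 2 = 1
      · have hSrev : S.reverse = S := by
          have h2 := hrev
          rw [hS, reverse_mul_of_domain, reverse_X_add_C_complex, h1, C_1, one_mul,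
            add_comm] at h2
          exact mul_left_cancel₀ (by simpa using (monic_X_add_C (1 : ℂ)).ne_zero) h2
        let _ : Invertible (-1 : ℂ) := ⟨-1, by norm_num, by norm_num⟩
        have h3 := eval₂_reverse_mul_pow (RingHom.id ℂ) (-1 : ℂ) S
        have h4 : (⅟(-1) : ℂ) = -1 := rfl
        rw [hSrev, hSdeg, h4, pow_succ, pow_mul] at h3
        norm_num at h3
        have h5 : w₀⁻¹ ^ 2 = 1 := by rw [inv_pow, h1, inv_one]
        rw [h5]
        change eval (-1) S = 0
        linear_combination -h3 / 2
      · have hRr : R.eval (-(w₀⁻¹ ^ 2)) = 0 := by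
          let _ : Invertible r := invertibleOfNonzero hr0
          have h3 := (eval₂_reverse_eq_zero_iff (RingHom.id ℂ) r R).mpr (by
            rw [eval₂_id]; exact hr)
          rw [hrev, eval₂_id, invOf_eq_inv] at h3
          rw [inv_pow, hw₀r, ← h3]
          congr 1
          rw [inv_neg, neg_neg]
        rw [hS, eval_mul, mul_eq_zero] at hRr
        refine hRr.resolve_left fun h4 => h1 ?_
        simp only [eval_add, eval_X, eval_C] at h4
        have h5 : w₀⁻¹ ^ 2 * w₀ ^ 2 = 1 := by rw [← mul_pow, inv_mul_cancel₀ hw₀0, one_pow]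
        have h6 : (w₀ ^ 2 - 1) * (w₀ ^ 2 + 1) = 0 := by linear_combination w₀ ^ 2 * h4 + h5
        rcases mul_eq_zero.mp h6 with h7 | h7
        · exact sub_eq_zero.mp h7
        · rw [← hw₀r, eq_neg_of_add_eq_zero_left h7, Complex.mem_slitPlane_iff] at hslit
          norm_num at hslit
    have hR₁m : R₁.Monic := hAmonic.of_mul_monic_left (hR₁ ▸ hR)
    obtain ⟨w, hw, hwR⟩ := ih R₁ hR₁m
      (by have := hAmonic.natDegree_mul hR₁m
          rw [← hR₁, hdeg, hAdeg] at this
          omega)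
      (by rw [hR₁, reverse_mul_of_domain, hArev] at hrev
          exact mul_left_cancel₀ hAmonic.ne_zero hrev)
      (fun x hx h => hroot x hx (by rw [hR₁, eval_mul, h, mul_zero]))
    refine ⟨Fin.cons w₀ w, fun j => ?_, ?_⟩
    · refine Fin.cases ?_ (fun j => ?_) j
      · simpa using hw₀
      · simpa using hw j
    · rw [Fin.prod_univ_succ, hR₁, hwR]
      simp [hA]

open Polynomial in
theorem PalindromicIntegral.IsEvenPalindromic.exists_factorization {n : ℕ} {Q : ℂ[X]}
    (hQ : PalindromicIntegral.IsEvenPalindromic n Q)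
    (hQ0 : ∀ x : ℝ, Q.eval (x : ℂ) ≠ 0) :
    ∃ w : Fin n → ℂ, (∀ j, 0 < (w j).re) ∧
      Q = ∏ j, ((X ^ 2 + C (w j ^ 2)) * (X ^ 2 + C ((w j)⁻¹ ^ 2))) := by
  have hexp : expand ℂ 2 (contract 2 Q) = Q := by
    ext i
    rw [coeff_expand two_pos]
    split_ifs with h
    · rw [coeff_contract two_ne_zero, Nat.div_mul_cancel h]
    · exact (hQ.even i (Nat.not_even_iff_odd.mp fun h' => h h'.two_dvd)).symm
  have hdeg : (contract 2 Q).natDegree = 2 * n := by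
    have := natDegree_expand 2 (contract 2 Q)
    rw [hexp, hQ.natDegree_eq] at this
    omega
  have hmonic : (contract 2 Q).Monic := by
    rw [Monic, leadingCoeff, hdeg, coeff_contract two_ne_zero, show 2 * n * 2 = 4 * n by ring,
      ← hQ.natDegree_eq]
    exact hQ.monic
  obtain ⟨w, hw, h⟩ := exists_palindromic_factorization n (contract 2 Q) hmonic hdeg
    (by
      ext i
      rw [coeff_reverse, hdeg, coeff_contract two_ne_zero, coeff_contract two_ne_zero]
      conv_rhs => rw [← hQ.palindromic, coeff_reverse, hQ.natDegree_eq]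
      congr 1
      rcases le_or_gt i (2 * n) with hi | hi
      · rw [revAt_le hi, revAt_le (by omega)]
        omega
      · rw [revAt_eq_self_of_lt hi, revAt_eq_self_of_lt (by omega)])
    (fun x hx hx0 => hQ0 (Real.sqrt x) (by
      rw [← hexp, expand_eval, ← Complex.ofReal_pow, Real.sq_sqrt hx, hx0]))
  refine ⟨w, hw, ?_⟩
  conv_lhs => rw [← hexp, h]
  simp [map_prod]

/-! ### The integral of `1 / (x² + z²)` -/

theorem re_add_ofReal_mul_I (z : ℂ) (x : ℝ) : (z + x * Complex.I).re = z.re := by simp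

/-- A logarithmic form of `z⁻¹ arctan(x/z)`; `z ± ix` stay in the right half-plane, away from the
branch cut. -/
theorem hasDerivAt_log_add_sub_log_sub {z : ℂ} (hz : 0 < z.re) (x : ℝ) :
    HasDerivAt (fun x : ℝ => (Complex.log (z + x * Complex.I) - Complex.log (z - x * Complex.I)) /
      (2 * z * Complex.I)) (1 / ((x : ℂ) ^ 2 + z ^ 2)) x := by
  have h1 : 0 < (z + x * Complex.I).re := by simpa using hz
  have h2 : 0 < (z - x * Complex.I).re := by simpa using hz
  have hx : HasDerivAt (fun x : ℝ => (x : ℂ) * Complex.I) (1 * Complex.I) x :=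
    (Complex.ofRealCLM.hasDerivAt (x := x)).mul_const _
  have d1 := (hx.const_add z).clog_real (Or.inl h1)
  have d2 := (hx.const_sub z).clog_real (Or.inl h2)
  refine ((d1.sub d2).div_const (2 * z * Complex.I)).congr_deriv ?_
  have n0 : z ≠ 0 := by rintro rfl; simp at hz
  have n1 : z + x * Complex.I ≠ 0 := fun h => by rw [h] at h1; simp at h1
  have n2 : z - x * Complex.I ≠ 0 := fun h => by rw [h] at h2; simp at h2
  have hfac : (x : ℂ) ^ 2 + z ^ 2 = (z + x * Complex.I) * (z - x * Complex.I) := by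
    linear_combination (x : ℂ) ^ 2 * Complex.I_sq
  have nI := Complex.I_ne_zero
  rw [hfac, div_sub_div _ _ n1 n2, div_div, div_eq_div_iff
    (mul_ne_zero (mul_ne_zero n1 n2) (mul_ne_zero (mul_ne_zero two_ne_zero n0) nI))
    (mul_ne_zero n1 n2)]
  ring

theorem tendsto_log_add_sub_log_sub (z : ℂ) :
    Filter.Tendsto (fun x : ℝ => Complex.log (z + x * Complex.I) - Complex.log (z - x * Complex.I))
      Filter.atTop (nhds (Real.pi * Complex.I)) := by
  have h0 : Filter.Tendsto (fun x : ℝ => z / (x : ℂ)) Filter.atTop (nhds 0) := by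
    have := (Complex.continuous_ofReal.tendsto 0).comp tendsto_inv_atTop_zero
    simpa [div_eq_mul_inv, Function.comp_def] using this.const_mul z
  -- Taking the positive factor `x` out of both logarithms cancels `log x`, and the remaining
  -- arguments tend to `±i`.
  have h1 : Filter.Tendsto (fun x : ℝ => Complex.log (z / x + Complex.I) -
      Complex.log (z / x - Complex.I)) Filter.atTop (nhds (Real.pi * Complex.I)) := by
    have a := (h0.add_const Complex.I).clog (by simp [Complex.mem_slitPlane_iff])
    have b := (h0.sub_const Complex.I).clog (by simp [Complex.mem_slitPlane_iff])
    have c := a.sub b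
    rw [zero_add, zero_sub, Complex.log_I, Complex.log_neg_I] at c
    convert c using 2
    ring
  refine h1.congr' ?_
  have e1 : ∀ᶠ x : ℝ in Filter.atTop, z / x + Complex.I ≠ 0 :=
    (h0.add_const Complex.I).eventually_ne (by simp)
  have e2 : ∀ᶠ x : ℝ in Filter.atTop, z / x - Complex.I ≠ 0 :=
    (h0.sub_const Complex.I).eventually_ne (by simp)
  filter_upwards [e1, e2, Filter.eventually_gt_atTop 0] with x hx1 hx2 hx
  have hxc : (x : ℂ) ≠ 0 := by exact_mod_cast hx.ne'
  have r1 : z + x * Complex.I = x * (z / x + Complex.I) := by field_simp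
  have r2 : z - x * Complex.I = x * (z / x - Complex.I) := by field_simp
  rw [r1, r2, Complex.log_ofReal_mul hx hx1, Complex.log_ofReal_mul hx hx2]
  ring

/-- On compact parts of the right half-plane, `|x² + z²|` is comparable to `1 + x²`. -/
theorem one_add_sq_le_mul_norm_sq_add_sq {c r : ℝ} (hc : 0 < c) {z : ℂ} (hz : c ≤ z.re)
    (hr : ‖z‖ ≤ r) (x : ℝ) :
    1 + x ^ 2 ≤ (c⁻¹ ^ 2 + (1 + r / c) ^ 2) * ‖(x : ℂ) ^ 2 + z ^ 2‖ := by
  -- With `u = |z + iy|`, both `c ≤ u` and `|y| ≤ u + r ≤ (1 + r/c) u`. The bound is used at `y = x`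
  -- and `y = -x`, for the two linear factors of `x² + z²`.
  have key : ∀ y : ℝ, 1 + y ^ 2 ≤ (c⁻¹ ^ 2 + (1 + r / c) ^ 2) * ‖z + y * Complex.I‖ ^ 2 := by
    intro y
    set u := ‖z + y * Complex.I‖
    have h1 : c ≤ u := by
      have := (Complex.re_le_norm (z + y * Complex.I))
      rw [re_add_ofReal_mul_I] at this
      exact hz.trans this
    have h2 : |y| ≤ u + r := by
      have : ‖(y : ℂ) * Complex.I‖ ≤ ‖z + y * Complex.I‖ + ‖z‖ := by
        simpa using norm_sub_le (z + y * Complex.I) z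
      rw [norm_mul, Complex.norm_I, mul_one, Complex.norm_real, Real.norm_eq_abs] at this
      linarith
    have hr0 : 0 ≤ r := (norm_nonneg z).trans hr
    have h3 : 1 ≤ c⁻¹ * u := by rw [inv_mul_eq_div, one_le_div hc]; exact h1
    have h4 : |y| ≤ (1 + r / c) * u := by
      have : r / c * u = r * (c⁻¹ * u) := by ring
      nlinarith
    have h5 : y ^ 2 ≤ ((1 + r / c) * u) ^ 2 := by
      rw [← sq_abs y]; exact pow_le_pow_left₀ (abs_nonneg _) h4 2
    have h6 : 1 ≤ (c⁻¹ * u) ^ 2 := one_le_pow₀ h3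
    nlinarith
  have hfac : (x : ℂ) ^ 2 + z ^ 2 = (z + x * Complex.I) * (z + (-x : ℝ) * Complex.I) := by
    push_cast
    linear_combination (x : ℂ) ^ 2 * Complex.I_sq
  rw [hfac, norm_mul]
  have k1 := key x
  have k2 := key (-x)
  rw [neg_sq] at k2
  have hK : 0 ≤ c⁻¹ ^ 2 + (1 + r / c) ^ 2 := by positivity
  refine (sq_le_sq₀ (by positivity) (by positivity)).mp ?_
  calc (1 + x ^ 2) ^ 2 = (1 + x ^ 2) * (1 + x ^ 2) := sq _
    _ ≤ _ := mul_le_mul k1 k2 (by positivity) (by positivity)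
    _ = _ := by ring

/-- A bound for the integrand that is locally uniform in the parameters. -/
theorem norm_one_div_prod_sq_add_sq_le {ι : Type*} [Fintype ι] [Nonempty ι] {c r : ℝ} (hc : 0 < c)
    {q : ι → ℂ} (hq : ∀ i, c ≤ (q i).re) (hr : ∀ i, ‖q i‖ ≤ r) (x : ℝ) :
    ‖1 / ∏ i, ((x : ℂ) ^ 2 + q i ^ 2)‖ ≤
      (c⁻¹ ^ 2 + (1 + r / c) ^ 2) ^ Fintype.card ι * (1 + x ^ 2)⁻¹ := by
  set K := c⁻¹ ^ 2 + (1 + r / c) ^ 2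
  have h : 1 + x ^ 2 ≤ K ^ Fintype.card ι * ∏ i, ‖(x : ℂ) ^ 2 + q i ^ 2‖ := by
    calc 1 + x ^ 2 ≤ (1 + x ^ 2) ^ Fintype.card ι :=
          le_self_pow₀ (by nlinarith [sq_nonneg x]) Fintype.card_ne_zero
      _ = ∏ _i : ι, (1 + x ^ 2) := by simp
      _ ≤ ∏ i, (K * ‖(x : ℂ) ^ 2 + q i ^ 2‖) := Finset.prod_le_prod (fun _ _ => by positivity)
          fun i _ => one_add_sq_le_mul_norm_sq_add_sq hc (hq i) (hr i) x
      _ = _ := by simp [Finset.prod_mul_distrib]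
  have hx : 0 < 1 + x ^ 2 := by positivity
  have hK : 0 ≤ K ^ Fintype.card ι := by positivity
  rw [norm_div, norm_one, norm_prod]
  set P := ∏ i, ‖(x : ℂ) ^ 2 + q i ^ 2‖
  have hP : 0 < P := by
    by_contra hP
    have := mul_nonpos_of_nonneg_of_nonpos hK (not_lt.mp hP)
    linarith
  rw [div_le_iff₀ hP, mul_right_comm, ← div_eq_mul_inv, one_le_div hx]
  exact h

theorem sq_add_sq_ne_zero_of_re_pos {z : ℂ} (hz : 0 < z.re) (x : ℝ) :
    (x : ℂ) ^ 2 + z ^ 2 ≠ 0 := by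
  intro h
  have := one_add_sq_le_mul_norm_sq_add_sq hz le_rfl le_rfl x
  rw [h, norm_zero, mul_zero] at this
  nlinarith [sq_nonneg x]

theorem continuous_one_div_prod_sq_add_sq {ι : Type*} [Fintype ι] {q : ι → ℂ}
    (hq : ∀ i, 0 < (q i).re) :
    Continuous fun x : ℝ => 1 / ∏ i, ((x : ℂ) ^ 2 + q i ^ 2) := by
  refine Continuous.div₀ continuous_const (by fun_prop) fun x => ?_
  exact Finset.prod_ne_zero_iff.mpr fun i _ => sq_add_sq_ne_zero_of_re_pos (hq i) x

theorem integrable_one_div_prod_sq_add_sq {ι : Type*} [Fintype ι] [Nonempty ι] {q : ι → ℂ}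
    (hq : ∀ i, 0 < (q i).re) :
    Integrable fun x : ℝ => 1 / ∏ i, ((x : ℂ) ^ 2 + q i ^ 2) := by
  obtain ⟨i₀, hi₀⟩ := Finite.exists_min fun i => (q i).re
  obtain ⟨i₁, hi₁⟩ := Finite.exists_max fun i => ‖q i‖
  exact (integrable_inv_one_add_sq.const_mul _).mono'
    (continuous_one_div_prod_sq_add_sq hq).aestronglyMeasurable
    (ae_of_all _ fun x => norm_one_div_prod_sq_add_sq_le (hq i₀) hi₀ hi₁ x)

theorem integrable_one_div_sq_add_sq {z : ℂ} (hz : 0 < z.re) :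
    Integrable fun x : ℝ => 1 / ((x : ℂ) ^ 2 + z ^ 2) := by
  simpa using integrable_one_div_prod_sq_add_sq (ι := Unit) (q := fun _ => z) fun _ => hz

theorem integral_Ioi_one_div_sq_add_sq {z : ℂ} (hz : 0 < z.re) :
    ∫ x in Set.Ioi (0 : ℝ), 1 / ((x : ℂ) ^ 2 + z ^ 2) = Real.pi / 2 * z⁻¹ := by
  have hz0 : z ≠ 0 := by rintro rfl; simp at hz
  have nI := Complex.I_ne_zero
  rw [integral_Ioi_of_hasDerivAt_of_tendsto'
    (fun x _ => hasDerivAt_log_add_sub_log_sub hz x)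
    (integrable_one_div_sq_add_sq hz).integrableOn
    ((tendsto_log_add_sub_log_sub z).div_const _)]
  simp
  field_simp

/-! ### Determinants -/

theorem det_pow_sub_eq_sign_mul_prod {R : Type*} [CommRing R] {N : ℕ} (x : Fin N → R) :
    (Matrix.of fun i j : Fin N => x i ^ (N - 1 - (j : ℕ))).det =
      Equiv.Perm.sign (Fin.revPerm : Equiv.Perm (Fin N)) *
        ∏ i : Fin N, ∏ j ∈ Finset.Ioi i, (x j - x i) := by
  have h : (Matrix.of fun i j : Fin N => x i ^ (N - 1 - (j : ℕ))) =
      (Matrix.vandermonde x).submatrix id Fin.revPerm := by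
    ext i j
    simp only [Matrix.of_apply, Matrix.submatrix_apply, Matrix.vandermonde_apply,
      Fin.revPerm_apply, Fin.val_rev, id]
    congr 1
    omega
  rw [h, Matrix.det_permute', Matrix.det_vandermonde]

/-- Replacing the constant column of a Vandermonde matrix by a column of values `f i` multiplies
the determinant by the constant coefficient of the polynomial interpolating `f`. -/
theorem det_updateCol_last_pow_sub {F : Type*} [Field F] {N : ℕ} {a : Fin (N + 1) → F}
    (ha : Function.Injective a) (f : Fin (N + 1) → F) :
    ((Matrix.of fun i j : Fin (N + 1) => a i ^ (N - (j : ℕ))).updateCol (Fin.last N) f).det =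
      (∑ i, f i * ∏ k ∈ Finset.univ.erase i, a k / (a k - a i)) *
        (Matrix.of fun i j : Fin (N + 1) => a i ^ (N - (j : ℕ))).det := by
  set V : Matrix (Fin (N + 1)) (Fin (N + 1)) F := Matrix.of fun i j => a i ^ (N - (j : ℕ)) with hV
  set P := Lagrange.interpolate Finset.univ a f with hP
  have hPdeg : P.degree < ((N + 1 : ℕ) : WithBot ℕ) := by
    simpa only [Finset.card_univ, Fintype.card_fin] using
      Lagrange.degree_interpolate_lt (s := Finset.univ) f ha.injOn
  have hPnat : P.natDegree < N + 1 := by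
    by_cases h0 : P = 0
    · simp [h0]
    · exact (Polynomial.natDegree_lt_iff_degree_lt h0).mpr hPdeg
  -- The coefficients of the interpolant solve the Vandermonde system; the last unknown is the
  -- constant term.
  have hsol : V.mulVec (fun j => P.coeff (N - (j : ℕ))) = f := by
    ext i
    have h := Lagrange.eval_interpolate_at_node f ha.injOn (Finset.mem_univ i)
    rw [← hP, Polynomial.eval_eq_sum_range' hPnat, ← Fin.sum_univ_eq_sum_range
      (fun k => P.coeff k * a i ^ k)] at h
    rw [← h, ← Equiv.sum_comp Fin.revPerm]
    simp only [Matrix.mulVec, dotProduct, hV, Matrix.of_apply, Fin.revPerm_apply, Fin.val_rev]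
    refine Finset.sum_congr rfl fun j _ => ?_
    rw [show N + 1 - ((j : ℕ) + 1) = N - j by omega, mul_comm]
  have h0 : P.coeff 0 = ∑ i, f i * ∏ k ∈ Finset.univ.erase i, a k / (a k - a i) := by
    rw [Polynomial.coeff_zero_eq_eval_zero, hP, Lagrange.interpolate_apply,
      Polynomial.eval_finsetSum]
    refine Finset.sum_congr rfl fun i _ => ?_
    rw [Polynomial.eval_mul, Polynomial.eval_C, Lagrange.basis, Polynomial.eval_prod]
    congr 1
    refine Finset.prod_congr rfl fun k hk => ?_
    have : a k - a i ≠ 0 := sub_ne_zero.mpr (ha.ne (Finset.ne_of_mem_erase hk))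
    have : a i - a k ≠ 0 := sub_ne_zero.mpr (ha.ne (Finset.ne_of_mem_erase hk).symm)
    simp only [Lagrange.basisDivisor, Polynomial.eval_mul, Polynomial.eval_C, Polynomial.eval_sub,
      Polynomial.eval_X]
    field_simp
    ring
  rw [← Matrix.cramer_apply, ← hsol, Matrix.cramer_eq_adjugate_mulVec, Matrix.mulVec_mulVec,
    Matrix.adjugate_mul, Matrix.smul_mulVec, Matrix.one_mulVec, hsol, ← h0]
  simp [mul_comm]

namespace PalindromicIntegral

theorem aeval_alternant {N : ℕ} (α : Fin N → ℕ) (q : Fin N → ℂ) :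
    MvPolynomial.aeval q (alternant α) = (Matrix.of fun i j : Fin N => q i ^ α j).det := by
  rw [alternant, AlgHom.map_det]
  congr 1
  ext i j
  simp

theorem aeval_alternant_mul_schur {N : ℕ} (μ : Fin N → ℕ) (q : Fin N → ℂ) :
    MvPolynomial.aeval q (alternant (staircase N : Fin N → ℕ)) * schur μ q =
      (Matrix.of fun i j : Fin N => q i ^ (μ j + staircase N j)).det := by
  rw [schur, ← map_mul, ← schurPoly_spec, aeval_alternant]
  rfl

theorem alternant_staircase_ne_zero {N : ℕ} : alternant (staircase N : Fin N → ℕ) ≠ 0 := by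
  rw [alternant_staircase.ne_zero_iff, Finset.prod_ne_zero_iff]
  rintro ⟨i, j⟩ hp
  exact (X_sub_X_prime (Finset.mem_filter.mp hp).2.ne').ne_zero

/-- Doubling the staircase exponents gives the Vandermonde determinant in the squares, and `X_j² -
X_i² = (X_j - X_i)(X_j + X_i)`. -/
theorem schurPoly_staircase {N : ℕ} :
    schurPoly (staircase N : Fin N → ℕ) =
      ∏ i : Fin N, ∏ j ∈ Finset.Ioi i, (MvPolynomial.X j + MvPolynomial.X i) := by
  refine mul_left_cancel₀ (alternant_staircase_ne_zero (N := N)) ?_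
  rw [← schurPoly_spec]
  have h1 := det_pow_sub_eq_sign_mul_prod
    fun i : Fin N => (MvPolynomial.X i : MvPolynomial (Fin N) ℤ)
  have h2 := det_pow_sub_eq_sign_mul_prod
    fun i : Fin N => (MvPolynomial.X i ^ 2 : MvPolynomial (Fin N) ℤ)
  have e2 : alternant (staircase N + staircase N : Fin N → ℕ) = (Matrix.of fun i j : Fin N =>
      (MvPolynomial.X i ^ 2 : MvPolynomial (Fin N) ℤ) ^ (N - 1 - (j : ℕ))).det := by
    rw [alternant]
    congr 1
    ext1 i j
    simp only [Matrix.of_apply, Pi.add_apply, staircase]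
    rw [← pow_mul, two_mul]
  rw [e2, h2]
  change _ = (Matrix.of fun i j : Fin N =>
    (MvPolynomial.X i : MvPolynomial (Fin N) ℤ) ^ (N - 1 - (j : ℕ))).det * _
  rw [h1, mul_assoc]
  simp only [← Finset.prod_mul_distrib]
  congr 1
  refine Finset.prod_congr rfl fun i _ => Finset.prod_congr rfl fun j _ => ?_
  ring

theorem schur_staircase_ne_zero {N : ℕ} {q : Fin N → ℂ} (hq : ∀ i, 0 < (q i).re) :
    schur (staircase N) q ≠ 0 := by
  rw [schur, schurPoly_staircase, map_prod, Finset.prod_ne_zero_iff]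
  intro i _
  rw [map_prod, Finset.prod_ne_zero_iff]
  intro j _ h
  have := congrArg Complex.re h
  simp only [map_add, MvPolynomial.aeval_X, Complex.add_re, Complex.zero_re] at this
  linarith [hq i, hq j]

theorem aeval_alternant_staircase_ne_zero {N : ℕ} {q : Fin N → ℂ} (hq : Function.Injective q) :
    MvPolynomial.aeval q (alternant (staircase N : Fin N → ℕ)) ≠ 0 := by
  rw [aeval_alternant]
  change (Matrix.of fun i j : Fin N => q i ^ (N - 1 - (j : ℕ))).det ≠ 0
  rw [det_pow_sub_eq_sign_mul_prod, ← Matrix.det_vandermonde]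
  refine mul_ne_zero ?_ (Matrix.det_vandermonde_ne_zero_iff.mpr hq)
  rcases Int.units_eq_one_or (Equiv.Perm.sign (Fin.revPerm : Equiv.Perm (Fin N))) with h | h <;>
    simp [h]

/-- For distinct variables, the quotient of the two staircase Schur polynomials is a sum of partial
fraction coefficients. -/
theorem schur_staircase_pred {N : ℕ} {q : Fin (N + 1) → ℂ} (hq : Function.Injective q)
    (hq2 : Function.Injective fun i => q i ^ 2) :
    (∏ i, q i) * schur (staircase N) q =
      (∑ i, q i * ∏ k ∈ Finset.univ.erase i, q k ^ 2 / (q k ^ 2 - q i ^ 2)) *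
        schur (staircase (N + 1)) q := by
  refine mul_left_cancel₀ (aeval_alternant_staircase_ne_zero hq) ?_
  rw [mul_left_comm, mul_left_comm (MvPolynomial.aeval q _), aeval_alternant_mul_schur,
    aeval_alternant_mul_schur, ← Matrix.det_mul_column]
  have h := det_updateCol_last_pow_sub hq2 q
  have e1 : (Matrix.of fun i j : Fin (N + 1) => (q i ^ 2) ^ (N - (j : ℕ))) =
      Matrix.of fun i j => q i ^ (staircase (N + 1) j + staircase (N + 1) j) := by
    ext i j
    simp only [Matrix.of_apply, staircase, ← pow_mul]
    congr 1
    omega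
  rw [← e1, ← h]
  congr 1
  ext i j
  rw [Matrix.updateCol_apply]
  simp only [Matrix.of_apply, staircase, ← pow_mul, ← pow_succ']
  -- In the last column the truncated subtraction makes both staircases `0`, so the exponent is `1`
  -- and the entry is `q i`; elsewhere it is `2(N - j)`.
  split_ifs with hj
  · subst hj
    simp
  · have : (j : ℕ) < N := Fin.val_lt_last hj
    congr 1
    omega

end PalindromicIntegral

/-! ### The general integral formula -/

/-- The Lagrange basis polynomials at the nodes `-a i` sum to `1`; evaluate at `y` and divide by the
product. -/
theorem sum_prod_div_sub_eq_one_div_prod_add {F ι : Type*} [Field F] [Fintype ι] [DecidableEq ι]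
    [Nonempty ι] {a : ι → F} (ha : Function.Injective a) {y : F} (hy : ∀ i, y + a i ≠ 0) :
    1 / ∏ i, (y + a i) =
      ∑ i, (∏ k ∈ Finset.univ.erase i, (a k - a i)⁻¹) * (1 / (y + a i)) := by
  have h := congrArg (Polynomial.eval y) (Lagrange.sum_basis (s := Finset.univ)
    (v := fun i => -a i) (neg_injective.comp ha).injOn Finset.univ_nonempty)
  rw [Polynomial.eval_finsetSum, Polynomial.eval_one] at h
  rw [div_eq_iff (Finset.prod_ne_zero_iff.mpr fun i _ => hy i)]
  refine h.symm.trans ?_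
  rw [Finset.sum_mul]
  refine Finset.sum_congr rfl fun i _ => ?_
  rw [Lagrange.basis, Polynomial.eval_prod, ← Finset.mul_prod_erase _ _ (Finset.mem_univ i),
    mul_assoc, ← mul_assoc (1 / (y + a i)), one_div_mul_cancel (hy i), one_mul,
    ← Finset.prod_mul_distrib]
  refine Finset.prod_congr rfl fun k _ => ?_
  simp only [Lagrange.basisDivisor, Polynomial.eval_mul, Polynomial.eval_C, Polynomial.eval_sub,
    Polynomial.eval_X]
  ring

namespace PalindromicIntegral

theorem integral_mul_prod_mul_schur_of_injective {N : ℕ} {q : Fin (N + 1) → ℂ}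
    (hq : ∀ i, 0 < (q i).re) (hinj : Function.Injective q) :
    (∫ x in Set.Ioi (0 : ℝ), 1 / ∏ i, ((x : ℂ) ^ 2 + q i ^ 2)) * (∏ i, q i) *
        schur (staircase (N + 1)) q = Real.pi / 2 * schur (staircase N) q := by
  -- Two points of the open right half-plane are never opposite.
  have hinj2 : Function.Injective fun i => q i ^ 2 := by
    intro i j h
    rcases sq_eq_sq_iff_eq_or_eq_neg.mp h with h | h
    · exact hinj h
    · have := congrArg Complex.re h
      rw [Complex.neg_re] at this
      linarith [hq i, hq j]
  have hq0 : ∀ i, q i ≠ 0 := fun i h => by simpa [h] using hq i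
  have hP : (∏ i, q i) ≠ 0 := Finset.prod_ne_zero_iff.mpr fun i _ => hq0 i
  have hint : ∫ x in Set.Ioi (0 : ℝ), 1 / ∏ i, ((x : ℂ) ^ 2 + q i ^ 2) =
      ∑ i, (∏ k ∈ Finset.univ.erase i, (q k ^ 2 - q i ^ 2)⁻¹) * (Real.pi / 2 * (q i)⁻¹) := by
    calc _ = ∫ x in Set.Ioi (0 : ℝ), ∑ i, (∏ k ∈ Finset.univ.erase i, (q k ^ 2 - q i ^ 2)⁻¹) *
          (1 / ((x : ℂ) ^ 2 + q i ^ 2)) := by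
          congr 1
          ext x
          exact sum_prod_div_sub_eq_one_div_prod_add hinj2
            fun i => sq_add_sq_ne_zero_of_re_pos (hq i) x
      _ = _ := by
          rw [integral_finsetSum _ fun i _ =>
            ((integrable_one_div_sq_add_sq (hq i)).integrableOn).const_mul _]
          refine Finset.sum_congr rfl fun i _ => ?_
          rw [integral_const_mul, integral_Ioi_one_div_sq_add_sq (hq i)]
  have key : (∫ x in Set.Ioi (0 : ℝ), 1 / ∏ i, ((x : ℂ) ^ 2 + q i ^ 2)) *
      ((∏ i, q i) * ∏ i, q i) =
      Real.pi / 2 * ∑ i, q i * ∏ k ∈ Finset.univ.erase i, q k ^ 2 / (q k ^ 2 - q i ^ 2) := by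
    rw [hint, Finset.sum_mul, Finset.mul_sum]
    refine Finset.sum_congr rfl fun i _ => ?_
    have h1 : (∏ k ∈ Finset.univ.erase i, q k ^ 2 / (q k ^ 2 - q i ^ 2)) * q i ^ 2 =
        (∏ k ∈ Finset.univ.erase i, (q k ^ 2 - q i ^ 2)⁻¹) * ((∏ i, q i) * ∏ i, q i) := by
      simp only [div_eq_mul_inv]
      rw [Finset.prod_mul_distrib, ← Finset.prod_mul_distrib (s := Finset.univ),
        ← Finset.mul_prod_erase _ _ (Finset.mem_univ i), Finset.prod_congr rfl fun k _ => sq (q k)]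
      ring
    have h2 := mul_inv_cancel₀ (hq0 i)
    linear_combination -(Real.pi / 2 * (q i)⁻¹) * h1 + Real.pi / 2 * q i *
      (∏ k ∈ Finset.univ.erase i, q k ^ 2 / (q k ^ 2 - q i ^ 2)) * h2
  refine mul_left_cancel₀ hP ?_
  linear_combination schur (staircase (N + 1)) q * key -
    Real.pi / 2 * schur_staircase_pred hinj hinj2

theorem continuous_schur {N : ℕ} (μ : Fin N → ℕ) : Continuous fun q : Fin N → ℂ => schur μ q := by
  simp only [schur, MvPolynomial.aeval_def, ← MvPolynomial.eval_map]
  exact MvPolynomial.continuous_eval _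

/-- The general formula, extended to repeated parameters by continuity. -/
theorem integral_mul_prod_mul_schur {N : ℕ} {q : Fin (N + 1) → ℂ} (hq : ∀ i, 0 < (q i).re) :
    (∫ x in Set.Ioi (0 : ℝ), 1 / ∏ i, ((x : ℂ) ^ 2 + q i ^ 2)) * (∏ i, q i) *
        schur (staircase (N + 1)) q = Real.pi / 2 * schur (staircase N) q := by
  -- For `t ≥ 0` these shifts do not decrease real parts, so one dominating function serves near
  -- `0`; two coordinates with different indices meet for at most one `t`.
  let p : ℝ → Fin (N + 1) → ℂ := fun t i => q i + (t * (i : ℕ) : ℝ)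
  have hp : Continuous p := by
    refine continuous_pi fun i => ?_
    exact continuous_const.add (Complex.continuous_ofReal.comp (continuous_id.mul continuous_const))
  have hp0 : p 0 = q := by ext i; simp [p]
  have hpt : Filter.Tendsto p (nhdsWithin 0 (Set.Ioi 0)) (nhds q) := by
    have := hp.tendsto 0
    rw [hp0] at this
    exact this.mono_left nhdsWithin_le_nhds
  have hpre : ∀ t, 0 ≤ t → ∀ i, (q i).re ≤ (p t i).re := fun t ht i => by
    simp only [p, Complex.add_re, Complex.ofReal_re, le_add_iff_nonneg_right]
    positivity
  have hinj : ∀ᶠ t in nhdsWithin (0 : ℝ) (Set.Ioi 0), Function.Injective (p t) := by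
    have : ∀ i j : Fin (N + 1), ∀ᶠ t in nhdsWithin (0 : ℝ) (Set.Ioi 0), p t i = p t j → i = j := by
      intro i j
      by_cases hij : i = j
      · exact Filter.Eventually.of_forall fun _ _ => hij
      · have hne : ((i : ℕ) : ℝ) - (j : ℕ) ≠ 0 :=
          sub_ne_zero.mpr fun h => hij (Fin.ext (by exact_mod_cast h))
        have hd : ∀ᶠ t in nhdsWithin (0 : ℝ) (Set.Ioi 0),
            t ≠ ((q j).re - (q i).re) / ((i : ℕ) - (j : ℕ)) := by
          rcases eq_or_ne (((q j).re - (q i).re) / (((i : ℕ) : ℝ) - (j : ℕ))) 0 with h | h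
          · rw [h]
            filter_upwards [self_mem_nhdsWithin] with t ht using ne_of_gt ht
          · exact nhdsWithin_le_nhds (isOpen_ne.mem_nhds h.symm)
        filter_upwards [hd] with t ht heq
        refine absurd ?_ ht
        rw [eq_div_iff hne]
        have := congrArg Complex.re heq
        simp only [p, Complex.add_re, Complex.ofReal_re] at this
        linarith
    filter_upwards [Filter.eventually_all.mpr fun i => Filter.eventually_all.mpr (this i)]
      with t ht i j using ht i j
  obtain ⟨i₀, hi₀⟩ := Finite.exists_min fun i => (q i).re
  have hint : Filter.Tendsto (fun t => ∫ x in Set.Ioi (0 : ℝ), 1 / ∏ i, ((x : ℂ) ^ 2 + p t i ^ 2))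
      (nhdsWithin 0 (Set.Ioi 0))
      (nhds (∫ x in Set.Ioi (0 : ℝ), 1 / ∏ i, ((x : ℂ) ^ 2 + q i ^ 2))) := by
    have hpos : ∀ᶠ t in nhdsWithin (0 : ℝ) (Set.Ioi 0), 0 < t := self_mem_nhdsWithin
    have hnorm : ∀ᶠ t in nhdsWithin (0 : ℝ) (Set.Ioi 0), ‖p t‖ < ‖q‖ + 1 :=
      hpt.norm.eventually_lt_const (lt_add_one _)
    refine tendsto_integral_filter_of_dominated_convergence _ ?_ ?_
      ((integrable_inv_one_add_sq.const_mul (((q i₀).re⁻¹ ^ 2 + (1 + (‖q‖ + 1) / (q i₀).re) ^ 2) ^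
        Fintype.card (Fin (N + 1)))).integrableOn) ?_
    · filter_upwards [hpos] with t ht
      exact (continuous_one_div_prod_sq_add_sq fun i =>
        (hq i).trans_le (hpre t ht.le i)).aestronglyMeasurable
    · filter_upwards [hpos, hnorm] with t ht htn
      exact ae_of_all _ fun x => norm_one_div_prod_sq_add_sq_le (hq i₀)
        (fun i => (hi₀ i).trans (hpre t ht.le i)) (fun i => (norm_le_pi_norm _ i).trans htn.le) x
    · refine ae_of_all _ fun x => Filter.Tendsto.div tendsto_const_nhds ?_
        (Finset.prod_ne_zero_iff.mpr fun i _ => sq_add_sq_ne_zero_of_re_pos (hq i) x)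
      exact tendsto_finsetProd _ fun i _ => ((tendsto_pi_nhds.mp hpt i).pow 2).const_add _
  have hl := (hint.mul (tendsto_finsetProd Finset.univ fun i _ => tendsto_pi_nhds.mp hpt i)).mul
    ((continuous_schur (staircase (N + 1))).tendsto q |>.comp hpt)
  have hr := ((continuous_schur (staircase N)).tendsto q |>.comp hpt).const_mul
    (Real.pi / 2 : ℂ)
  refine tendsto_nhds_unique_of_eventuallyEq hl hr ?_
  filter_upwards [hinj, self_mem_nhdsWithin] with t ht htpos
  exact integral_mul_prod_mul_schur_of_injective
    (fun i => (hq i).trans_le (hpre t (le_of_lt htpos) i)) ht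

theorem prod_concatTuple {M : Type*} [CommMonoid M] {n m : ℕ} (w : Fin n → ℂ) (f : ℂ → M) :
    ∏ k, f (concatTuple m w k) = (∏ j, f (w j) * f (w j)⁻¹) ^ m := by
  rw [← Equiv.prod_comp finProdFinEquiv, Fintype.prod_prod_type, ← Finset.prod_pow]
  refine Finset.prod_congr rfl fun j _ => ?_
  have h : ∀ i : Fin (2 * m), f (concatTuple m w (finProdFinEquiv (j, i))) =
      if (i : ℕ) < m then f (w j) else f (w j)⁻¹ := by
    intro i
    have h1 : (finProdFinEquiv (j, i)).divNat = j :=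
      congrArg Prod.fst (finProdFinEquiv.symm_apply_apply (j, i))
    have h2 : (finProdFinEquiv (j, i)).modNat = i :=
      congrArg Prod.snd (finProdFinEquiv.symm_apply_apply (j, i))
    rw [concatTuple, h1, h2]
    split_ifs <;> rfl
  simp only [h]
  rw [Fin.prod_univ_eq_prod_range (fun i => if i < m then f (w j) else f (w j)⁻¹) (2 * m),
    two_mul, Finset.prod_range_add, mul_pow]
  congr 1
  · rw [Finset.prod_congr rfl fun i hi => if_pos (Finset.mem_range.mp hi)]
    simp
  · simp

theorem re_concatTuple_pos {n m : ℕ} {w : Fin n → ℂ} (hw : ∀ j, 0 < (w j).re)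
    (k : Fin (n * (2 * m))) : 0 < (concatTuple m w k).re := by
  rw [concatTuple]
  split_ifs
  · exact hw _
  · rw [Complex.inv_re]
    refine div_pos (hw _) (Complex.normSq_pos.mpr fun h => ?_)
    have := hw k.divNat
    rw [h] at this
    simp at this

theorem integral_one_div_prod_sq_add_sq {N : ℕ} (hN : 0 < N) {q : Fin N → ℂ}
    (hq : ∀ i, 0 < (q i).re) (hprod : ∏ i, q i = 1) :
    ∫ x in Set.Ioi (0 : ℝ), 1 / ∏ i, ((x : ℂ) ^ 2 + q i ^ 2) =
      Real.pi / 2 * (schur (staircase (N - 1)) q / schur (staircase N) q) := by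
  obtain ⟨N, rfl⟩ := Nat.exists_eq_add_one_of_ne_zero hN.ne'
  rw [← mul_div_assoc, eq_div_iff (schur_staircase_ne_zero hq), Nat.add_sub_cancel,
    ← integral_mul_prod_mul_schur hq, hprod, mul_one]

end PalindromicIntegral

theorem mainTheorem5 (n m : ℕ) (hn : 1 ≤ n) (hm : 1 ≤ m) (Q : Polynomial ℂ)
    (hQ : PalindromicIntegral.IsEvenPalindromic n Q)
    (hQ0 : ∀ x : ℝ, Q.eval (x : ℂ) ≠ 0) :
    (∃ w : Fin n → ℂ, (∀ j, 0 < (w j).re) ∧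
      Q = ∏ j, ((Polynomial.X ^ 2 + Polynomial.C (w j ^ 2)) *
        (Polynomial.X ^ 2 + Polynomial.C ((w j)⁻¹ ^ 2)))) ∧
    ∀ w : Fin n → ℂ, (∀ j, 0 < (w j).re) →
      Q = ∏ j, ((Polynomial.X ^ 2 + Polynomial.C (w j ^ 2)) *
        (Polynomial.X ^ 2 + Polynomial.C ((w j)⁻¹ ^ 2))) →
      IntegrableOn (fun x : ℝ => 1 / Q.eval (x : ℂ) ^ m) (Set.Ioi 0) ∧
      PalindromicIntegral.schur (PalindromicIntegral.staircase (2 * n * m))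
        (PalindromicIntegral.concatTuple m w) ≠ 0 ∧
      ∫ x in Set.Ioi (0 : ℝ), 1 / Q.eval (x : ℂ) ^ m =
        (Real.pi / 2 : ℂ) *
          (PalindromicIntegral.schur (PalindromicIntegral.staircase (2 * n * m - 1))
              (PalindromicIntegral.concatTuple m w) /
            PalindromicIntegral.schur (PalindromicIntegral.staircase (2 * n * m))
              (PalindromicIntegral.concatTuple m w)) := by
  refine ⟨hQ.exists_factorization hQ0, fun w hw hQw => ?_⟩
  have hN : 0 < n * (2 * m) := by positivity
  have : Nonempty (Fin (n * (2 * m))) := ⟨⟨0, hN⟩⟩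
  have hq := PalindromicIntegral.re_concatTuple_pos (m := m) hw
  have hw0 : ∀ j, w j ≠ 0 := fun j h => by simpa [h] using hw j
  have hprod : ∏ k, PalindromicIntegral.concatTuple m w k = 1 := by
    rw [PalindromicIntegral.prod_concatTuple w fun z => z,
      Finset.prod_eq_one fun j _ => mul_inv_cancel₀ (hw0 j), one_pow]
  have heval : ∀ x : ℝ, Q.eval (x : ℂ) ^ m =
      ∏ k, ((x : ℂ) ^ 2 + PalindromicIntegral.concatTuple m w k ^ 2) := by
    intro x
    rw [PalindromicIntegral.prod_concatTuple w fun z => (x : ℂ) ^ 2 + z ^ 2, hQw,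
      Polynomial.eval_prod]
    simp
  rw [show 2 * n * m = n * (2 * m) by ring]
  simp only [heval]
  exact ⟨(integrable_one_div_prod_sq_add_sq hq).integrableOn,
    PalindromicIntegral.schur_staircase_ne_zero hq,
    PalindromicIntegral.integral_one_div_prod_sq_add_sq hN hq hprod⟩
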